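/- Let $(A,\mathfrak m)$ be a Noetherian local ring and let $(B,\mathfrak n)$ be a Noetherian local ring that is a flat $A$-algebra with $\mathfrak n=\mathfrak m B$. Let $X$ be a set, let $\mathcal U$ be an ultrafilter on $X$, and let $A_\natural=A^X/\mathcal U$ be the corresponding ultrapower of $A$ (families $X\to A$ modulo equality on a member of $\mathcal U$), regarded as an $A$-algebra via the diagonal map. Then every $A$-algebra homomorphism $B\to A_\natural$, if one exists, is faithfully flat. -/

import Mathlib

/-- The `A`-algebra structure on a reduced power `A^X / l`, given by `a ↦` the class of the
constant family with value `a`. The scalar multiplication is the pointwise one on germs. -/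
noncomputable instance Filter.Germ.instAlgebraReducedPower {X A : Type*} [CommRing A]
    (l : Filter X) : Algebra A (Filter.Germ l A) where
  algebraMap := (Filter.Germ.coeRingHom l).comp (Pi.constRingHom X A)
  commutes' _ _ := mul_comm _ _
  smul_def' a x := by
    induction x using Filter.Germ.inductionOn with
    | h f => rfl

/-- The ultrapower `A^X / U` of a commutative ring `A` along an ultrafilter `U` on a set `X`:
families `X → A` modulo equality on a member of `U`, with pointwise ring operations and the
diagonal `A`-algebra structure. -/
abbrev Ultrapower (A : Type*) {X : Type*} (U : Ultrafilter X) : Type _ :=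
  Filter.Germ (U : Filter X) A

/-! Flatness over `B` is tested on ideals `I` of `B` by Noetherian induction on injectivity of `I ⊗
A_♮ → A_♮`. If `I` contains `𝔪B = 𝔫`, it is `𝔫` or `B`, so it is extended from `A`, and flatness of
`A_♮` over `A` suffices. Otherwise choose `a ∈ 𝔪` whose image `x` is not in `I`. Injectivity for `I
+ (x)` shows that the kernel for `I` is the image under `x` of the kernel for `(I : x)`. If `(I :
x)` is strictly larger than `I`, that kernel is zero by induction. If `(I : x) = I`, the kernel
equals `x` times itself, and Nakayama, carried out in the factors of the ultrapower, kills it.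
Faithfulness holds because `𝔫A_♮ = 𝔪A_♮` is proper. -/

open TensorProduct in
/-- A relation killing an element of `I ⊗ M` in `(I + (x)) ⊗ M` comes from the colon ideal
`K = (I : x)`, by tensoring the exact sequence `K → I × R → I + (x) → 0`. -/
theorem Ideal.exists_rTensor_colon_of_sup_span_singleton {R M : Type*} [CommRing R]
    [AddCommGroup M] [Module R M] (I K : Ideal R) (x : R) (hK : ∀ t, t ∈ K ↔ x * t ∈ I)
    (hJ : Function.Injective ((I ⊔ Ideal.span {x} : Ideal R).subtype.rTensor M))
    (τ : I ⊗[R] M) (hτ : I.subtype.rTensor M τ = 0) :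
    ∃ ω : K ⊗[R] M, K.subtype.rTensor M ω = 0 ∧
      τ = (((LinearMap.lsmul R R x).restrict fun t ht ↦ (hK t).1 ht : K →ₗ[R] I)).rTensor M ω := by
  set m : K →ₗ[R] I := (LinearMap.lsmul R R x).restrict fun t ht ↦ (hK t).1 ht with hm
  let J : Ideal R := I ⊔ Ideal.span {x}
  -- The sign makes `g ∘ f` zero; the second coordinate of `f` later gives the vanishing of `ω` and
  -- the first gives `τ`.
  let f : K →ₗ[R] I × R := m.prod (-K.subtype)
  let g₀ : I × R →ₗ[R] R := I.subtype.coprod (LinearMap.lsmul R R x)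
  have hxJ : x ∈ J := Ideal.mem_sup_right (Ideal.mem_span_singleton_self x)
  let g : I × R →ₗ[R] J := g₀.codRestrict J fun p ↦
    J.add_mem (Ideal.mem_sup_left p.1.2) (J.mul_mem_right _ hxJ)
  have hg₀ (p : I × R) : ((g p : J) : R) = p.1 + x * p.2 := rfl
  have hgs : Function.Surjective g := by
    rintro ⟨y, hy⟩
    obtain ⟨i, hi, z, hz, rfl⟩ := Submodule.mem_sup.1 hy
    obtain ⟨r, rfl⟩ := Ideal.mem_span_singleton'.1 hz
    exact ⟨(⟨i, hi⟩, r), Subtype.ext (by rw [hg₀, mul_comm x])⟩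
  have hfg : Function.Exact f g := by
    intro p
    constructor
    · intro hp
      have hp' : (p.1 : R) + x * p.2 = 0 := by rw [← hg₀, hp]; rfl
      have hmem : -p.2 ∈ K := by
        rw [hK, mul_neg, ← eq_neg_of_add_eq_zero_left hp']
        exact p.1.2
      refine ⟨⟨-p.2, hmem⟩, Prod.ext (Subtype.ext ?_) (neg_neg _)⟩
      change x * -p.2 = p.1
      rw [mul_neg, ← eq_neg_of_add_eq_zero_left hp']
    · rintro ⟨t, rfl⟩
      refine Subtype.ext ?_
      rw [hg₀]
      change x * (t : R) + x * -(t : R) = 0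
      ring
  have hz : g.rTensor M ((LinearMap.inl R I R).rTensor M τ) = 0 := by
    apply hJ
    rw [map_zero, ← LinearMap.comp_apply, ← LinearMap.comp_apply, ← LinearMap.rTensor_comp,
      ← LinearMap.rTensor_comp, ← hτ]
    congr 2
    ext i
    change (i : R) + x * 0 = i
    simp
  obtain ⟨ω, hω⟩ := (rTensor_exact M hfg hgs _).1 hz
  refine ⟨ω, ?_, ?_⟩
  · have h := congrArg ((LinearMap.snd R I R).rTensor M) hω
    rw [← LinearMap.comp_apply, ← LinearMap.comp_apply, ← LinearMap.rTensor_comp,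
      ← LinearMap.rTensor_comp, LinearMap.snd_comp_inl, LinearMap.rTensor_zero,
      show LinearMap.snd R I R ∘ₗ f = -K.subtype from rfl, LinearMap.rTensor_neg] at h
    simpa using h
  · have h := congrArg ((LinearMap.fst R I R).rTensor M) hω
    rw [← LinearMap.comp_apply, ← LinearMap.comp_apply, ← LinearMap.rTensor_comp,
      ← LinearMap.rTensor_comp, LinearMap.fst_comp_inl, LinearMap.rTensor_id,
      show LinearMap.fst R I R ∘ₗ f = m from rfl] at h
    exact h.symm

open TensorProduct in
theorem TensorProduct.exists_eq_sum_tmul_of_span_eq_top {R M N ι : Type*} [CommRing R]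
    [AddCommGroup M] [Module R M] [AddCommGroup N] [Module R N] [Fintype ι] (b : ι → M)
    (hb : Submodule.span R (Set.range b) = ⊤) (τ : M ⊗[R] N) :
    ∃ c : ι → N, τ = ∑ i, b i ⊗ₜ c i := by
  induction τ with
  | zero => exact ⟨0, by simp⟩
  | add τ σ h₁ h₂ =>
    obtain ⟨c, rfl⟩ := h₁
    obtain ⟨d, rfl⟩ := h₂
    exact ⟨c + d, by simp [tmul_add, Finset.sum_add_distrib]⟩
  | tmul m y =>
    obtain ⟨r, rfl⟩ := (Submodule.mem_span_range_iff_exists_fun R).1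
      (hb ▸ Submodule.mem_top : m ∈ Submodule.span R (Set.range b))
    exact ⟨fun i ↦ r i • y, by simp [sum_tmul, smul_tmul]⟩

/-! ### Linear relations in reduced powers and ultrapowers -/

namespace Filter.Germ

variable {A X : Type*} [CommRing A] {l : Filter X}

theorem exists_pi_coeRingHom_eq {ι : Type*} (c : ι → Germ l A) :
    ∃ f : X → ι → A, ∀ i, c i = coeRingHom l fun ξ ↦ f ξ i := by
  choose g hg using fun i ↦ Quotient.exists_rep (c i)
  exact ⟨fun ξ i ↦ g i ξ, fun i ↦ (hg i).symm⟩

theorem coeRingHom_eq_iff {f g : X → A} :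
    coeRingHom l f = coeRingHom l g ↔ ∀ᶠ ξ in l, f ξ = g ξ :=
  Germ.coe_eq

theorem coeRingHom_eq_zero_iff {f : X → A} :
    coeRingHom l f = 0 ↔ ∀ᶠ ξ in l, f ξ = 0 :=
  Germ.coe_eq

theorem smul_coeRingHom (a : A) (f : X → A) :
    a • coeRingHom l f = coeRingHom l fun ξ ↦ a * f ξ :=
  rfl

theorem sum_mul_coeRingHom {ι : Type*} [Fintype ι] (f g : X → ι → A) :
    ∑ i, coeRingHom l (fun ξ ↦ f ξ i) * coeRingHom l (fun ξ ↦ g ξ i) =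
      coeRingHom l fun ξ ↦ ∑ i, f ξ i * g ξ i := by
  simp_rw [← map_mul, ← map_sum]
  congr 1
  ext ξ
  simp

/-- The equational criterion of flatness for reduced powers of a Noetherian ring. -/
theorem exists_sum_smul_of_sum_smul_eq_zero [IsNoetherianRing A] {ι : Type*} [Fintype ι]
    (a : ι → A) (c : ι → Germ l A) (h : ∑ i, a i • c i = 0) :
    ∃ (r : ℕ) (σ : Fin r → ι → A) (u : Fin r → Germ l A),
      (∀ j, ∑ i, σ j i * a i = 0) ∧ ∀ i, c i = ∑ j, σ j i • u j := by
  classical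
  let S : Submodule A (ι → A) := LinearMap.ker (Fintype.linearCombination A a)
  have hS (v : ι → A) : v ∈ S ↔ ∑ i, v i * a i = 0 := by
    simp [S, LinearMap.mem_ker, Fintype.linearCombination_apply]
  obtain ⟨r, σ, hσ⟩ := Submodule.fg_iff_exists_fin_generating_family.1 (IsNoetherian.noetherian S)
  obtain ⟨f, hf⟩ := exists_pi_coeRingHom_eq c
  have hfS : ∀ᶠ ξ in l, f ξ ∈ S := by
    simp_rw [hf, smul_coeRingHom, ← map_sum] at h
    filter_upwards [coeRingHom_eq_zero_iff.1 h] with ξ hξ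
    rw [hS, ← hξ, Finset.sum_apply]
    exact Finset.sum_congr rfl fun i _ ↦ mul_comm _ _
  have hu : ∀ ξ, ∃ u : Fin r → A, f ξ ∈ S → ∑ j, u j • σ j = f ξ := by
    intro ξ
    by_cases hξ : f ξ ∈ S
    · rw [← hσ, Submodule.mem_span_range_iff_exists_fun] at hξ
      exact hξ.imp fun u hu _ ↦ hu
    · exact ⟨0, fun h ↦ absurd h hξ⟩
  choose u hu using hu
  refine ⟨r, σ, fun j ↦ coeRingHom l fun ξ ↦ u ξ j, fun j ↦ ?_, fun i ↦ ?_⟩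
  · rw [← hS, ← hσ]
    exact Submodule.subset_span ⟨j, rfl⟩
  · simp_rw [hf, smul_coeRingHom, ← map_sum]
    rw [coeRingHom_eq_iff]
    filter_upwards [hfS] with ξ hξ
    rw [← hu ξ hξ]
    simp [mul_comm]

/-- **Nakayama's lemma in an ultrapower**. The module of relations of `β` need not be finitely
generated over the ultrapower, so the usual lemma is applied in almost every factor. -/
theorem exists_sum_mul_of_forall_exists_add_smul [IsNoetherianRing A] [IsLocalRing A]
    {U : Ultrafilter X} {ι κ : Type*} [Fintype ι] [Fintype κ] (β : ι → Ultrapower A U)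
    (σ : κ → ι → Ultrapower A U) {a : A} (ha : a ∈ IsLocalRing.maximalIdeal A)
    (h : ∀ c : ι → Ultrapower A U, ∑ i, β i * c i = 0 →
      ∃ (u : κ → Ultrapower A U) (d : ι → Ultrapower A U), ∑ i, β i * d i = 0 ∧
        ∀ i, c i = ∑ j, u j * σ j i + a • d i)
    (c : ι → Ultrapower A U) (hc : ∑ i, β i * c i = 0) :
    ∃ u : κ → Ultrapower A U, ∀ i, c i = ∑ j, u j * σ j i := by
  classical
  obtain ⟨b, hb⟩ := exists_pi_coeRingHom_eq β
  obtain ⟨s, hs⟩ := exists_pi_coeRingHom_eq fun p : κ × ι ↦ σ p.1 p.2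
  let K (ξ : X) : Submodule A (ι → A) := LinearMap.ker (Fintype.linearCombination A (b ξ))
  have hK (ξ : X) (v : ι → A) : v ∈ K ξ ↔ ∑ i, b ξ i * v i = 0 := by
    simp [K, LinearMap.mem_ker, Fintype.linearCombination_apply, mul_comm]
  let S (ξ : X) : Submodule A (ι → A) :=
    Submodule.span A (Set.range fun (j : κ) (i : ι) ↦ s ξ (j, i))
  have hS (ξ : X) (v : ι → A) : v ∈ S ξ ↔ ∃ u : κ → A, ∀ i, v i = ∑ j, u j * s ξ (j, i) := by
    simp only [S, Submodule.mem_span_range_iff_exists_fun, funext_iff, Finset.sum_apply,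
      Pi.smul_apply, smul_eq_mul, eq_comm]
  have relation_iff (f : X → ι → A) :
      ∑ i, β i * coeRingHom (U : Filter X) (fun ξ ↦ f ξ i) = 0 ↔
        ∀ᶠ ξ in (U : Filter X), f ξ ∈ K ξ := by
    simp_rw [hb, hK]
    rw [sum_mul_coeRingHom, coeRingHom_eq_zero_iff]
  have hSK : ∀ᶠ ξ in (U : Filter X), K ξ ≤ S ξ := by
    have key : ∀ᶠ ξ in (U : Filter X), K ξ ≤ S ξ ⊔ Ideal.span {a} • K ξ := by
      -- Wherever the inclusion fails, `f ξ` is a counterexample to it, so the hypothesis applied to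
      -- this one family settles almost every factor.
      have hf : ∀ ξ, ∃ f : ι → A, f ∈ K ξ ∧
          (f ∈ S ξ ⊔ Ideal.span {a} • K ξ → K ξ ≤ S ξ ⊔ Ideal.span {a} • K ξ) := by
        intro ξ
        by_cases hle : K ξ ≤ S ξ ⊔ Ideal.span {a} • K ξ
        · exact ⟨0, zero_mem _, fun _ ↦ hle⟩
        · obtain ⟨f, hf, hf'⟩ := SetLike.not_le_iff_exists.1 hle
          exact ⟨f, hf, fun h ↦ absurd h hf'⟩
      choose f hfK hf using hf
      obtain ⟨u, d, hd, hcd⟩ := h (fun i ↦ coeRingHom _ fun ξ ↦ f ξ i)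
        ((relation_iff f).2 (Eventually.of_forall hfK))
      obtain ⟨u, hu⟩ := exists_pi_coeRingHom_eq u
      obtain ⟨d, hd'⟩ := exists_pi_coeRingHom_eq d
      obtain rfl := funext hd'
      have hall : ∀ᶠ ξ in (U : Filter X), ∀ i,
          f ξ i = ∑ j, u ξ j * s ξ (j, i) + a * d ξ i := by
        rw [eventually_all]
        intro i
        have h₁ := hcd i
        simp_rw [hu, fun j ↦ hs (j, i), smul_coeRingHom] at h₁
        rw [sum_mul_coeRingHom u fun ξ j ↦ s ξ (j, i), ← map_add, coeRingHom_eq_iff] at h₁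
        exact h₁
      filter_upwards [hall, (relation_iff d).1 hd] with ξ h₁ h₂
      apply hf
      rw [show f ξ = (fun i ↦ ∑ j, u ξ j * s ξ (j, i)) + a • d ξ from funext h₁]
      exact Submodule.add_mem_sup ((hS ξ _).2 ⟨u ξ, fun _ ↦ rfl⟩)
        (Submodule.smul_mem_smul (Ideal.mem_span_singleton_self a) h₂)
    filter_upwards [key] with ξ hξ
    refine Submodule.le_of_le_smul_of_le_jacobson_bot (IsNoetherian.noetherian _) ?_ hξ
    rw [IsLocalRing.jacobson_eq_maximalIdeal _ bot_ne_top, Ideal.span_singleton_le_iff_mem]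
    exact ha
  obtain ⟨f, hf⟩ := exists_pi_coeRingHom_eq c
  obtain rfl := funext hf
  have hu : ∀ ξ, ∃ u : κ → A, f ξ ∈ S ξ → ∀ i, f ξ i = ∑ j, u j * s ξ (j, i) := by
    intro ξ
    by_cases hξ : f ξ ∈ S ξ
    · exact ((hS ξ _).1 hξ).imp fun u hu _ ↦ hu
    · exact ⟨0, fun h ↦ absurd h hξ⟩
  choose u hu using hu
  refine ⟨fun j ↦ coeRingHom _ fun ξ ↦ u ξ j, fun i ↦ ?_⟩
  simp_rw [fun j ↦ hs (j, i)]
  rw [sum_mul_coeRingHom u fun ξ j ↦ s ξ (j, i), coeRingHom_eq_iff]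
  filter_upwards [hSK, (relation_iff f).1 hc] with ξ h₁ h₂
  exact hu ξ (h₁ h₂) i

theorem exists_eventually_mem_of_mem_map_algebraMap (I : Ideal A) {y : Germ l A}
    (hy : y ∈ I.map (algebraMap A (Germ l A))) :
    ∃ f : X → A, y = coeRingHom l f ∧ ∀ᶠ ξ in l, f ξ ∈ I := by
  induction hy using Submodule.span_induction with
  | mem y hy =>
    obtain ⟨a, ha, rfl⟩ := hy
    exact ⟨fun _ ↦ a, rfl, Eventually.of_forall fun _ ↦ ha⟩
  | zero => exact ⟨0, (map_zero _).symm, Eventually.of_forall fun _ ↦ I.zero_mem⟩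
  | add y z _ _ hy hz =>
    obtain ⟨f, rfl, hf⟩ := hy
    obtain ⟨g, rfl, hg⟩ := hz
    exact ⟨f + g, (map_add _ _ _).symm, (hf.and hg).mono fun ξ h ↦ I.add_mem h.1 h.2⟩
  | smul x y _ hy =>
    obtain ⟨f, rfl, hf⟩ := hy
    obtain ⟨g, rfl⟩ := Quotient.exists_rep x
    exact ⟨g * f, rfl, hf.mono fun ξ h ↦ I.mul_mem_left _ h⟩

theorem map_algebraMap_ne_top [l.NeBot] {I : Ideal A} (hI : I ≠ ⊤) :
    I.map (algebraMap A (Germ l A)) ≠ ⊤ := by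
  intro h
  obtain ⟨f, hf, hfI⟩ := exists_eventually_mem_of_mem_map_algebraMap (l := l) I
    (h ▸ Submodule.mem_top : (1 : Germ l A) ∈ _)
  rw [← map_one (coeRingHom l), coeRingHom_eq_iff] at hf
  obtain ⟨ξ, h₁, h₂⟩ := (hf.and hfI).exists
  exact hI ((Ideal.eq_top_iff_one I).2 (by rwa [← h₁] at h₂))

end Filter.Germ

/-! ### Flatness of the ultrapower over `B` -/

namespace Ultrapower

open Filter.Germ TensorProduct

variable {A B X : Type*} [CommRing A] [CommRing B] [Algebra A B] {U : Ultrafilter X}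
  [Algebra B (Ultrapower A U)] [IsScalarTower A B (Ultrapower A U)]

/-- Generators of `I` over `A` also generate its extension, and the `A`-relations that trivialize a
relation in the ultrapower remain relations in `B`. -/
theorem rTensor_map_algebraMap_injective [IsNoetherianRing A] (I : Ideal A) :
    Function.Injective ((I.map (algebraMap A B)).subtype.rTensor (Ultrapower A U)) := by
  rw [injective_iff_map_eq_zero]
  intro τ hτ
  obtain ⟨n, a, ha⟩ := Submodule.fg_iff_exists_fin_generating_family.1 (IsNoetherian.noetherian I)
  have haI (i) : a i ∈ I := ha ▸ Submodule.subset_span ⟨i, rfl⟩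
  let b : Fin n → I.map (algebraMap A B) :=
    fun i ↦ ⟨algebraMap A B (a i), Ideal.mem_map_of_mem _ (haI i)⟩
  have hb : Submodule.span B (Set.range b) = ⊤ := by
    apply Submodule.map_injective_of_injective (Submodule.injective_subtype _)
    rw [Submodule.map_span, Submodule.map_top, Submodule.range_subtype, ← Set.range_comp]
    conv_rhs => rw [← ha]
    change _ = Ideal.map (algebraMap A B) (Ideal.span (Set.range a))
    rw [Ideal.map_span, ← Set.range_comp]
    rfl
  obtain ⟨c, rfl⟩ := exists_eq_sum_tmul_of_span_eq_top b hb τ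
  have hc : ∑ i, a i • c i = 0 := by
    have h := congrArg (TensorProduct.lid B (Ultrapower A U)) hτ
    simpa [b] using h
  obtain ⟨r, σ, u, hσ, hu⟩ := exists_sum_smul_of_sum_smul_eq_zero a c hc
  apply sum_tmul_eq_zero_of_vanishesTrivially
  refine ⟨r, fun i j ↦ algebraMap A B (σ j i), u, fun i ↦ ?_, fun j ↦ Subtype.ext ?_⟩
  · simp [hu i]
  · have h := congrArg (algebraMap A B) (hσ j)
    simpa [b, Algebra.smul_def] using h

/-- Kernel elements are relations among generators of `I` with coefficients in the ultrapower, and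
they vanish when they come from relations over `B`. The hypothesis says this holds up to `a` times a
relation, as Nakayama requires. -/
theorem rTensor_injective_of_forall_exists_eq_smul [IsNoetherianRing A] [IsLocalRing A]
    [IsNoetherianRing B] (I : Ideal B) {a : A} (ha : a ∈ IsLocalRing.maximalIdeal A)
    (h : ∀ τ : I ⊗[B] Ultrapower A U, I.subtype.rTensor _ τ = 0 →
      ∃ ω : I ⊗[B] Ultrapower A U, I.subtype.rTensor _ ω = 0 ∧ τ = algebraMap A B a • ω) :
    Function.Injective (I.subtype.rTensor (Ultrapower A U)) := by
  rw [injective_iff_map_eq_zero]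
  intro τ hτ
  obtain ⟨n, b, hb⟩ := Submodule.fg_iff_exists_fin_generating_family.1
    (Module.Finite.fg_top : (⊤ : Submodule B I).FG)
  let S : Submodule B (Fin n → B) := LinearMap.ker (Fintype.linearCombination B b)
  have hS (v : Fin n → B) : v ∈ S ↔ ∑ i, v i • b i = 0 := by
    simp [S, LinearMap.mem_ker, Fintype.linearCombination_apply]
  obtain ⟨r, σ, hσ⟩ := Submodule.fg_iff_exists_fin_generating_family.1 (IsNoetherian.noetherian S)
  have relation_iff (c : Fin n → Ultrapower A U) :
      I.subtype.rTensor (Ultrapower A U) (∑ i, b i ⊗ₜ[B] c i) = 0 ↔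
        ∑ i, algebraMap B (Ultrapower A U) (b i) * c i = 0 := by
    rw [← (TensorProduct.lid B (Ultrapower A U)).map_eq_zero_iff]
    simp [Algebra.smul_def]
  obtain ⟨c, rfl⟩ := exists_eq_sum_tmul_of_span_eq_top b hb τ
  have hex : ∃ u : Fin r → Ultrapower A U,
      ∀ i, c i = ∑ j, u j * algebraMap B (Ultrapower A U) (σ j i) := by
    refine exists_sum_mul_of_forall_exists_add_smul
      (fun i ↦ algebraMap B (Ultrapower A U) (b i))
      (fun j i ↦ algebraMap B (Ultrapower A U) (σ j i)) ha ?_ c ((relation_iff c).1 hτ)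
    intro c hc
    obtain ⟨ω, hω, hcω⟩ := h _ ((relation_iff c).2 hc)
    obtain ⟨d, rfl⟩ := exists_eq_sum_tmul_of_span_eq_top b hb ω
    have hcd : ∑ i, b i ⊗ₜ[B] (c i - a • d i) = 0 := by
      simp_rw [tmul_sub, Finset.sum_sub_distrib, hcω, Finset.smul_sum, ← tmul_smul,
        algebraMap_smul, sub_self]
    -- The vanishing tensor writes `c - a • d` through relations over `B`, which are then expanded
    -- in the fixed generators `σ`.
    obtain ⟨k, s, y, hy, hs⟩ := vanishesTrivially_of_sum_tmul_eq_zero B hb hcd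
    have hv (j : Fin k) : ∃ v : Fin r → B, ∑ q, v q • σ q = fun i ↦ s i j := by
      rw [← Submodule.mem_span_range_iff_exists_fun, hσ, hS]
      exact hs j
    choose v hv using hv
    refine ⟨fun q ↦ ∑ j, v j q • y j, d, (relation_iff d).1 hω, fun i ↦ ?_⟩
    refine sub_eq_iff_eq_add.1 ((hy i).trans ?_)
    have hsi (j : Fin k) : s i j = ∑ q, v j q * σ q i := by
      simpa using (congrFun (hv j) i).symm
    simp_rw [hsi, Finset.sum_smul, Finset.sum_mul, Algebra.smul_def, map_mul]
    rw [Finset.sum_comm]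
    exact Finset.sum_congr rfl fun q _ ↦ Finset.sum_congr rfl fun j _ ↦ by ring
  obtain ⟨u, hu⟩ := hex
  apply sum_tmul_eq_zero_of_vanishesTrivially
  refine ⟨r, fun i j ↦ σ j i, u, fun i ↦ ?_, fun j ↦ ?_⟩
  · simp [hu i, Algebra.smul_def, mul_comm]
  · rw [← hS, ← hσ]
    exact Submodule.subset_span ⟨j, rfl⟩

theorem flat_of_maximalIdeal_eq_map [IsNoetherianRing A] [IsLocalRing A] [IsNoetherianRing B]
    [IsLocalRing B] (hmax : IsLocalRing.maximalIdeal B =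
      (IsLocalRing.maximalIdeal A).map (algebraMap A B)) :
    Module.Flat B (Ultrapower A U) := by
  rw [Module.Flat.iff_rTensor_injective']
  intro I
  induction I using WellFoundedGT.induction with
  | ind I ih =>
  by_cases hI : (IsLocalRing.maximalIdeal A).map (algebraMap A B) ≤ I
  · rw [← hmax] at hI
    obtain rfl | h := eq_or_ne I ⊤
    · rw [← Ideal.map_top (algebraMap A B)]
      exact rTensor_map_algebraMap_injective ⊤
    · rw [hI.antisymm' (IsLocalRing.le_maximalIdeal h), hmax]
      exact rTensor_map_algebraMap_injective _
  · rw [Ideal.map_le_iff_le_comap, SetLike.not_le_iff_exists] at hI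
    obtain ⟨a, ha, haI⟩ := hI
    set x : B := algebraMap A B a with hx
    let K : Ideal B := Submodule.comap (LinearMap.lsmul B B x) I
    have hK (t : B) : t ∈ K ↔ x * t ∈ I := Iff.rfl
    have hIK : I ≤ K := fun t ht ↦ I.mul_mem_left x ht
    have hJ := ih (I ⊔ Ideal.span {x}) (left_lt_sup.2 fun hle ↦
      haI (hle (Ideal.mem_span_singleton_self x)))
    have key := Ideal.exists_rTensor_colon_of_sup_span_singleton I K x hK hJ
    obtain hlt | heq := hIK.lt_or_eq
    · rw [injective_iff_map_eq_zero]
      intro τ hτ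
      obtain ⟨ω, hω, rfl⟩ := key τ hτ
      rw [(injective_iff_map_eq_zero _).1 (ih K hlt) ω hω, map_zero]
    · clear_value K
      subst heq
      refine rTensor_injective_of_forall_exists_eq_smul I ha fun τ hτ ↦ ?_
      obtain ⟨ω, hω, hτω⟩ := key τ hτ
      refine ⟨ω, hω, hτω.trans ?_⟩
      exact LinearMap.congr_fun (LinearMap.rTensor_smul (Ultrapower A U) x LinearMap.id |>.trans
        (by rw [LinearMap.rTensor_id])) ω

end Ultrapower

theorem mainTheorem3
    {A B X : Type*}
    [CommRing A] [IsLocalRing A] [IsNoetherianRing A]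
    [CommRing B] [IsLocalRing B] [IsNoetherianRing B]
    [Algebra A B] [Module.Flat A B]
    (hmax : IsLocalRing.maximalIdeal B =
      (IsLocalRing.maximalIdeal A).map (algebraMap A B))
    (U : Ultrafilter X)
    (φ : B →ₐ[A] Ultrapower A U) :
    (φ : B →+* Ultrapower A U).FaithfullyFlat := by
  let : Algebra B (Ultrapower A U) := (φ : B →+* Ultrapower A U).toAlgebra
  have : IsScalarTower A B (Ultrapower A U) :=
    IsScalarTower.of_algebraMap_eq fun a ↦ (φ.commutes a).symm
  have hflat : Module.Flat B (Ultrapower A U) := Ultrapower.flat_of_maximalIdeal_eq_map hmax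
  refine Module.FaithfullyFlat.mk fun {n} hn htop ↦ ?_
  rw [IsLocalRing.eq_maximalIdeal hn, hmax, Ideal.smul_top_eq_map, Ideal.map_map,
    ← IsScalarTower.algebraMap_eq] at htop
  exact Filter.Germ.map_algebraMap_ne_top (IsLocalRing.maximalIdeal.isMaximal A).ne_top
    (by simpa using htop)
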